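/- Let $\mathsf T$ be an essentially small triangulated category with suspension $\Sigma$. Call an essentially small triangulated category $\mathsf C$ *locally noetherian* if every cohomological functor $\mathsf C^{\mathrm{op}}\to\mathsf{Ab}$ (an additive functor taking exact triangles to exact sequences) is isomorphic to a direct sum of representable functors $\operatorname{Hom}_{\mathsf C}(-,X_i)$, and *locally finite* if both $\mathsf C$ and $\mathsf C^{\mathrm{op}}$ are locally noetherian. A *thick* subcategory is a full triangulated subcategory closed under direct summands. Let $\mathbf T(\mathsf C)$ be the set of thick subcategories of $\mathsf C$, ordered by inclusion; it is a complete lattice in which the infimum is the intersection and the supremum of a family is the intersection of all thick subcategories containing all of its members. For $\mathsf U\in\mathbf T(\mathsf T)$ the thick subcategories $\mathsf U^\perp$ and ${}^\perp\mathsf U$ of $\mathsf T$ are the full subcategories with objects $$\mathsf U^\perp=\{Y\mid \operatorname{Hom}_{\mathsf T}(X,Y)=0\ \text{for all }X\in\mathsf U\},\qquad {}^\perp\mathsf U=\{X\mid \operatorname{Hom}_{\mathsf T}(X,Y)=0\ \text{for all }Y\in\mathsf U\}.$$ Suppose that $\mathsf T$ is locally finite. 1. The maps $\mathbf T(\mathsf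 T)\to\mathbf T(\mathsf T)$ taking $\mathsf U$ to $\mathsf U^\perp$ and to ${}^\perp\mathsf U$ are mutually inverse: ${}^\perp(\mathsf U^\perp)=\mathsf U=({}^\perp\mathsf U)^\perp$ for every $\mathsf U$. They are order-reversing, so $\mathsf U\mapsto\mathsf U^\perp$ is an isomorphism from $\mathbf T(\mathsf T)$ onto its opposite lattice, with inverse $\mathsf U\mapsto{}^\perp\mathsf U$; thus the lattice $\mathbf T(\mathsf T)$ is self-dual. 2. For every thick subcategory $\mathsf U$ of $\mathsf T$, $\mathsf U\wedge\mathsf U^\perp=0$ (the subcategory of zero objects) and $\mathsf U\vee\mathsf U^\perp=\mathsf T$. 3. Let $\mathsf V\subseteq\mathsf U\subseteq\mathsf T$ be thick subcategories. Then the Verdier quotient $\mathsf U/\mathsf V$ is a locally finite (in particular essentially small) triangulated category, and there is a lattice isomorphism $$[\mathsf V,\mathsf U]=\{\mathsf X\in\mathbf T(\mathsf T)\mid \mathsf V\subseteq\mathsf X\subseteq\mathsf U\}\xrightarrow{\ \sim\ }\mathbf T(\mathsf U/\mathsf V)$$ taking $\mathsf X$ to $\mathsf X/\mathsf V$. Here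 the canonical functor $\mathsf X/\mathsf V\to\mathsf U/\mathsf V$ is fully faithful, and $\mathsf X/\mathsf V$ is identified with its essential image. -/

import Mathlib

open CategoryTheory CategoryTheory.Limits CategoryTheory.Pretriangulated

universe w v u

section LocallyFinite

open Opposite
open scoped DirectSum CategoryTheory.Pretriangulated.Opposite

/-- A contravariant functor `F` from a preadditive category `C` to abelian groups is a direct sum
of representable functors: there are a (small) family of objects `X i` and isomorphisms of
abelian groups `⨁ i, Hom (Y, X i) ≃ F Y` which are natural in `Y`. The homomorphism
`Preadditive.leftComp (X i) f : Hom (Y, X i) → Hom (Z, X i)` is precomposition with `f : Z ⟶ Y`. -/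
def IsDirectSumOfRepresentables {C : Type u} [Category.{v} C] [Preadditive C]
    (F : Cᵒᵖ ⥤ AddCommGrpCat.{w}) : Prop :=
  ∃ (I : Type w) (X : I → C) (e : ∀ Y : C, (⨁ i, (Y ⟶ X i)) ≃+ F.obj (op Y)),
    ∀ (Y Z : C) (f : Z ⟶ Y) (x : ⨁ i, (Y ⟶ X i)),
      e Z (DirectSum.map (fun i => Preadditive.leftComp (X i) f) x) = F.map f.op (e Y x)

/-- Every cohomological functor `Cᵒᵖ ⥤ Ab` (that is, every functor taking exact triangles to
exact sequences) is a direct sum of representable functors. The universe `w` is the one in which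
`C` is essentially small; abelian groups and index sets live there. -/
def IsLocallyNoetherian (C : Type u) [Category.{v} C] [HasZeroObject C] [HasShift C ℤ]
    [Preadditive C] [∀ n : ℤ, (shiftFunctor C n).Additive] [Pretriangulated C] : Prop :=
  ∀ F : Cᵒᵖ ⥤ AddCommGrpCat.{w}, F.IsHomological → IsDirectSumOfRepresentables.{w} F

/-- A triangulated category `C` is locally finite if it is essentially small and both `C` and
its opposite (with the opposite triangulation) are locally noetherian. -/
structure IsLocallyFinite (C : Type u) [Category.{v} C] [HasZeroObject C] [HasShift C ℤ]
    [Preadditive C] [∀ n : ℤ, (shiftFunctor C n).Additive] [Pretriangulated C]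
    [IsTriangulated C] : Prop where
  essentiallySmall : EssentiallySmall.{w} C
  locallyNoetherian : IsLocallyNoetherian.{w} C
  locallyNoetherian_op : IsLocallyNoetherian.{w} Cᵒᵖ

end LocallyFinite

/-- A thick subcategory of a triangulated category: a full triangulated subcategory (given by
its objects) closed under direct summands, hence in particular under isomorphisms. -/
@[ext]
structure ThickSubcategory (C : Type u) [Category.{v} C] [HasZeroObject C] [HasShift C ℤ]
    [Preadditive C] [∀ n : ℤ, (shiftFunctor C n).Additive] [Pretriangulated C] where
  /-- The predicate of belonging to the subcategory. -/
  obj : ObjectProperty C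
  isTriangulated : obj.IsTriangulated
  isStableUnderRetracts : obj.IsStableUnderRetracts

namespace ThickSubcategory

open scoped ZeroObject

attribute [instance] isTriangulated isStableUnderRetracts

section

variable {C : Type u} [Category.{v} C] [HasZeroObject C] [HasShift C ℤ]
  [Preadditive C] [∀ n : ℤ, (shiftFunctor C n).Additive] [Pretriangulated C]

/-- Thick subcategories are ordered by inclusion. -/
instance : PartialOrder (ThickSubcategory C) :=
  PartialOrder.lift obj fun _ _ h => ThickSubcategory.ext h

/-- The infimum of a collection of thick subcategories is its intersection. -/
instance : InfSet (ThickSubcategory C) where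
  sInf S :=
    { obj := fun X => ∀ U ∈ S, U.obj X
      isTriangulated :=
        { exists_zero := ⟨0, isZero_zero C, fun U _ => U.obj.prop_zero⟩
          isStableUnderShiftBy := fun n => ⟨fun _ hX U hU => U.obj.le_shift n _ (hX U hU)⟩
          ext₂' := fun T hT h₁ h₃ => ObjectProperty.le_isoClosure _ _ fun U hU =>
            U.obj.ext_of_isTriangulatedClosed₂ T hT (h₁ U hU) (h₃ U hU) }
      isStableUnderRetracts :=
        { of_retract := fun r h U hU => U.obj.prop_of_retract r (h U hU) } }

theorem isGLB_sInf (S : Set (ThickSubcategory C)) : IsGLB S (sInf S) :=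
  ⟨fun U hU _ hX => hX U hU, fun _ hW X hX _ hU => hW hU X hX⟩

/-- The intersection of two thick subcategories. -/
instance : Min (ThickSubcategory C) where
  min U V :=
    { obj := fun X => U.obj X ∧ V.obj X
      isTriangulated :=
        { exists_zero := ⟨0, isZero_zero C, U.obj.prop_zero, V.obj.prop_zero⟩
          isStableUnderShiftBy := fun n =>
            ⟨fun _ hX => ⟨U.obj.le_shift n _ hX.1, V.obj.le_shift n _ hX.2⟩⟩
          ext₂' := fun T hT h₁ h₃ => ObjectProperty.le_isoClosure _ _
            ⟨U.obj.ext_of_isTriangulatedClosed₂ T hT h₁.1 h₃.1,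
              V.obj.ext_of_isTriangulatedClosed₂ T hT h₁.2 h₃.2⟩ }
      isStableUnderRetracts :=
        { of_retract := fun r h => ⟨U.obj.prop_of_retract r h.1, V.obj.prop_of_retract r h.2⟩ } }

/-- The whole category. -/
instance : Top (ThickSubcategory C) where
  top :=
    { obj := fun _ => True
      isTriangulated :=
        { exists_zero := ⟨0, isZero_zero C, trivial⟩
          isStableUnderShiftBy := fun _ => ⟨fun _ _ => trivial⟩
          ext₂' := fun _ _ _ _ => ObjectProperty.le_isoClosure _ _ trivial }
      isStableUnderRetracts := { of_retract := fun _ _ => trivial } }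

/-- The zero subcategory, consisting of all zero objects. -/
instance : Bot (ThickSubcategory C) where
  bot :=
    { obj := fun X => IsZero X
      isTriangulated :=
        { exists_zero := ⟨0, isZero_zero C, isZero_zero C⟩
          isStableUnderShiftBy := fun n => ⟨fun _ hX => (shiftFunctor C n).map_isZero hX⟩
          ext₂' := fun T hT h₁ h₃ => ObjectProperty.le_isoClosure _ _
            (Triangle.isZero₂_of_isZero₁₃ T hT h₁ h₃) }
      isStableUnderRetracts :=
        { of_retract := fun r h => by
            rw [IsZero.iff_id_eq_zero, ← r.retract, h.eq_of_tgt r.i 0, zero_comp] } }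

/-- The complete lattice of thick subcategories. The supremum of a collection is the
intersection of all thick subcategories containing its members. -/
instance : CompleteLattice (ThickSubcategory C) :=
  { completeLatticeOfInf (ThickSubcategory C) isGLB_sInf with
    inf := min
    inf_le_left := fun _ _ _ h => h.1
    inf_le_right := fun _ _ _ h => h.2
    le_inf := fun _ _ _ h₁ h₂ X h => ⟨h₁ X h, h₂ X h⟩
    top := ⊤
    le_top := fun _ _ _ => trivial
    bot := ⊥
    bot_le := fun U _ hX => U.obj.prop_of_isZero hX }

/-- `U^⊥`: the objects `Y` with `Hom (X, Y) = 0` for all `X` in `U`. -/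
def rightPerp (U : ThickSubcategory C) : ThickSubcategory C where
  obj := U.obj.rightOrthogonal
  isTriangulated := inferInstance
  isStableUnderRetracts :=
    { of_retract := fun r h X f hX => by
        rw [← Category.comp_id f, ← r.retract, ← Category.assoc, h (f ≫ r.i) hX, zero_comp] }

/-- `^⊥U`: the objects `X` with `Hom (X, Y) = 0` for all `Y` in `U`. -/
def leftPerp (U : ThickSubcategory C) : ThickSubcategory C where
  obj := U.obj.leftOrthogonal
  isTriangulated := inferInstance
  isStableUnderRetracts :=
    { of_retract := fun r h Y f hY => by
        rw [← Category.id_comp f, ← r.retract, Category.assoc, h (r.r ≫ f) hY, comp_zero] }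

/-- A thick subcategory, as a triangulated category of its own. -/
abbrev Carrier (U : ThickSubcategory C) : Type u := U.obj.FullSubcategory

/-- For thick subcategories `V` and `U` of `C`, the objects of `U` which belong to `V`, as a
thick subcategory of `U`. This is `V` itself when `V ≤ U`. -/
def restrict (V U : ThickSubcategory C) : ThickSubcategory U.Carrier where
  obj := V.obj.inverseImage U.obj.ι
  isTriangulated := inferInstance
  isStableUnderRetracts :=
    { of_retract := fun r h => V.obj.prop_of_retract (r.map U.obj.ι) h }

/-- The Verdier quotient `C / V`: the localization of `C` at the morphisms whose cone is in
`V`, with exact triangles those isomorphic to images of exact triangles of `C`. -/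
abbrev VerdierQuotient [IsTriangulated C] (V : ThickSubcategory C) := V.obj.trW.Localization

/-- The Verdier quotient `U / V` for thick subcategories `V ≤ U` of `C`. -/
abbrev SubQuotient [IsTriangulated C] (U V : ThickSubcategory C) := (V.restrict U).VerdierQuotient

/-- For `X ≤ U`, the canonical functor `X / V ⥤ U / V` induced by the inclusion of `X`
into `U`. -/
noncomputable def quotientFunctor [IsTriangulated C] {X U : ThickSubcategory C} (h : X ≤ U)
    (V : ThickSubcategory C) : SubQuotient X V ⥤ SubQuotient U V :=
  Localization.lift (ObjectProperty.ιOfLE h ⋙ (V.restrict U).obj.trW.Q) (W := (V.restrict X).obj.trW)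
    (fun _ _ f hf => Localization.inverts (V.restrict U).obj.trW.Q (V.restrict U).obj.trW _
      ((ObjectProperty.inverseImage_trW_iff V.obj U.obj.ι _).2
        ((ObjectProperty.inverseImage_trW_iff V.obj X.obj.ι f).1 hf)))
    (V.restrict X).obj.trW.Q

end

end ThickSubcategory

/-! Everything rests on one approximation: for `P` thick in a locally noetherian category `C`, each
`X` lies in a triangle `A → X → X' →` with `A` in `P` and `X'` in `P^⊥`.

To obtain it, let `L : C ⥤ C/P` be the quotient functor and `F` cohomological on `C/P`. The pullback
of `F` along `L` is a sum of functors `Hom(-, X i)`. It vanishes on `P`, so every `X i` lies in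
`P^⊥`, where `Hom(Y, X i) = Hom(LY, LX i)`. Hence `F` is the sum of the `Hom(-, LX i)`, and `C/P` is
again locally noetherian. Taking `F = Hom(-, LX)`, the identity of `LX` involves only finitely many
summands, so `LX ≅ LX'` with `X'` a finite sum of the `X i`. This isomorphism lifts to `X → X'`,
whose cone `L` kills and which therefore lies in `P` up to shift.

The triangle gives `U ∨ U^⊥ = T`. If `X` is in `^⊥(P^⊥)`, then `X → X'` is zero and `X` is a retract
of `A`; thus `^⊥(P^⊥) = P`, and the other identity is dual. Since `U = (^⊥U)^⊥`, the inclusion of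
`U` has a left adjoint exhibiting `U` as `T/^⊥U`. So `U`, and then `U/V`, is locally finite. The
lattice isomorphism in (3) needs no finiteness: the kernel of `C → C/R` is exactly `R`, so thick
subcategories are recovered from their images. -/

section

open Opposite
open scoped DirectSum ZeroObject CategoryTheory.Pretriangulated.Opposite

universe v' u'

/-! ### Sums of representable functors -/

section Yoneda

variable {C : Type u} [Category.{v} C] [Preadditive C] {I : Type w}

open Classical in
/-- The homomorphism `⨁ i, Hom (Y, X i) → F Y` given by elements of the groups `F (X i)`. -/
noncomputable def yonedaSum (F : Cᵒᵖ ⥤ AddCommGrpCat.{w}) [F.Additive] (X : I → C)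
    (ε : ∀ i, F.obj (op (X i))) (Y : C) : (⨁ i, (Y ⟶ X i)) →+ F.obj (op Y) :=
  DirectSum.toAddMonoid fun i =>
    { toFun := fun f => F.map f.op (ε i)
      map_zero' := by simp
      map_add' := fun f g => by simp [F.map_add] }

variable (F : Cᵒᵖ ⥤ AddCommGrpCat.{w}) [F.Additive] (X : I → C) (ε : ∀ i, F.obj (op (X i)))

@[simp]
lemma yonedaSum_of [DecidableEq I] (Y : C) (i : I) (f : Y ⟶ X i) :
    yonedaSum F X ε Y (DirectSum.of (fun i => (Y ⟶ X i)) i f) = F.map f.op (ε i) := by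
  obtain rfl := Subsingleton.elim ‹DecidableEq I› fun a b => Classical.propDecidable (a = b)
  classical
  exact DirectSum.toAddMonoid_of _ _ _

@[simp]
lemma CategoryTheory.Preadditive.leftComp_apply' {X Y : C} (Z : C) (f : X ⟶ Y) (g : Y ⟶ Z) :
    Preadditive.leftComp Z f g = f ≫ g :=
  rfl

lemma yonedaSum_naturality {Y Z : C} (f : Z ⟶ Y) (x : ⨁ i, (Y ⟶ X i)) :
    yonedaSum F X ε Z (DirectSum.map (fun i => Preadditive.leftComp (X i) f) x) =
      F.map f.op (yonedaSum F X ε Y x) := by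
  classical
  induction x using DirectSum.induction_on with
  | zero => simp
  | of i g => simp [DirectSum.map_of]
  | add x y hx hy => simp [hx, hy]

lemma isDirectSumOfRepresentables_of_bijective_yonedaSum
    (h : ∀ Y, Function.Bijective (yonedaSum F X ε Y)) : IsDirectSumOfRepresentables.{w} F :=
  ⟨I, X, fun Y => AddEquiv.ofBijective _ (h Y), fun _ _ f x => yonedaSum_naturality F X ε f x⟩

/-- By Yoneda, a natural isomorphism is determined by the images of the identities of the `X i`;
these are the elements `ε i`. -/
lemma IsDirectSumOfRepresentables.exists_bijective_yonedaSum
    (h : IsDirectSumOfRepresentables.{w} F) :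
    ∃ (I : Type w) (X : I → C) (ε : ∀ i, F.obj (op (X i))),
      ∀ Y, Function.Bijective (yonedaSum F X ε Y) := by
  classical
  obtain ⟨I, X, e, he⟩ := h
  refine ⟨I, X, fun i => e (X i) (DirectSum.of (fun j => (X i ⟶ X j)) i (𝟙 _)), fun Y => ?_⟩
  convert (e Y).bijective
  ext x
  induction x using DirectSum.induction_on with
  | zero => simp
  | of i g => simp [← he, DirectSum.map_of]
  | add x y hx hy => simp [hx, hy]

lemma bijective_yonedaSum_of_iso {Y Z : C} (i : Y ≅ Z)
    (h : Function.Bijective (yonedaSum F X ε Y)) : Function.Bijective (yonedaSum F X ε Z) := by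
  have hc : ∀ {A B : C} (j : A ≅ B), Function.Bijective
      (DirectSum.map (fun k => Preadditive.leftComp (X k) j.hom)) := by
    classical
    intro A B j
    refine Function.bijective_iff_has_inverse.2
      ⟨DirectSum.map (fun k => Preadditive.leftComp (X k) j.inv), fun x => ?_, fun x => ?_⟩ <;>
    induction x using DirectSum.induction_on with
    | zero => simp
    | of i g => simp [DirectSum.map_of]
    | add x y hx hy => rw [map_add, map_add, hx, hy]
  have hF : Function.Bijective (F.map i.hom.op) :=
    ConcreteCategory.bijective_of_isIso (F.map i.hom.op)
  have : ∀ x, yonedaSum F X ε Y _ = F.map i.hom.op (yonedaSum F X ε Z x) :=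
    fun x => yonedaSum_naturality F X ε i.hom x
  have h2 := (h.comp (hc i))
  have h3 : (F.map i.hom.op) ∘ (yonedaSum F X ε Z) = _ := (funext this).symm
  refine (Function.Bijective.of_comp_iff' hF _).1 ?_
  rw [h3]
  exact h2

variable {D : Type u'} [Category.{v'} D] [Preadditive D]

/-- This compares sums of representables before and after applying `L`, so that bijectivity can be
transferred to a quotient. -/
lemma yonedaSum_comp (L : D ⥤ C) [L.Additive] [(L.op ⋙ F).Additive] (X : I → D)
    (ε : ∀ i, F.obj (op (L.obj (X i)))) (Y : D) (x : ⨁ i, (Y ⟶ X i)) :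
    yonedaSum F (fun i => L.obj (X i)) ε (L.obj Y)
        (DirectSum.map (fun _ => L.mapAddHom) x) = yonedaSum (L.op ⋙ F) X ε Y x := by
  classical
  induction x using DirectSum.induction_on with
  | zero => simp
  | of i g => simp [DirectSum.map_of]
  | add x y hx hy => simp [hx, hy]

end Yoneda

/-! ### Cohomological functors on Verdier quotients -/

section Localization

variable {C : Type u} [Category.{v} C] [HasZeroObject C] [HasShift C ℤ]
  [Preadditive C] [∀ n : ℤ, (shiftFunctor C n).Additive] [Pretriangulated C]
  {D : Type u'} [Category.{v'} D] [HasZeroObject D] [HasShift D ℤ]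
  [Preadditive D] [∀ n : ℤ, (shiftFunctor D n).Additive] [Pretriangulated D]

lemma CategoryTheory.ObjectProperty.isZero_of_isLocalization_trW (P : ObjectProperty C) (L : C ⥤ D)
    [L.CommShift ℤ] [L.IsTriangulated] [L.IsLocalization P.trW] {A : C} (hA : P A) :
    IsZero (L.obj A) := by
  have h : P.trW (0 : 0 ⟶ A) := ObjectProperty.trW.mk P (contractible_distinguished₁ A) hA
  have := Localization.inverts L P.trW _ h
  exact (L.map_isZero (isZero_zero C)).of_iso (asIso (L.map (0 : 0 ⟶ A))).symm

variable [IsTriangulated C]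
  (P : ObjectProperty C) [P.IsTriangulated] (L : C ⥤ D) [L.CommShift ℤ] [L.IsTriangulated]
  [L.IsLocalization P.trW]

/-- A cohomological functor on a Verdier quotient of a locally noetherian category is a direct
sum of functors represented by local objects. -/
lemma IsLocallyNoetherian.exists_bijective_yonedaSum_of_isLocalization
    (hC : IsLocallyNoetherian.{w} C) (F : Dᵒᵖ ⥤ AddCommGrpCat.{w}) [F.IsHomological] :
    ∃ (I : Type w) (X : I → C) (ε : ∀ i, F.obj (op (L.obj (X i)))),
      (∀ i, P.rightOrthogonal (X i)) ∧
      ∀ Y, Function.Bijective (yonedaSum F (fun i => L.obj (X i)) ε Y) := by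
  classical
  obtain ⟨I, X, ε, h⟩ := (hC (L.op ⋙ F) inferInstance).exists_bijective_yonedaSum
  -- For `A` in `P`, the group `Hom(A, X i)` is a summand of `F(LA) = 0`.
  have hX : ∀ i, P.rightOrthogonal (X i) := by
    intro i A f hA
    have hz := F.map_isZero (P.isZero_of_isLocalization_trW L hA).op
    have := (h A).injective (a₁ := DirectSum.of _ i f) (a₂ := 0)
      ((AddCommGrpCat.subsingleton_of_isZero hz).elim _ _)
    exact DirectSum.of_injective (β := fun j => (A ⟶ X j)) i (by simpa using this)
  refine ⟨I, X, ε, hX, fun Y => ?_⟩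
  have := Localization.essSurj L P.trW
  refine bijective_yonedaSum_of_iso _ _ _ (L.objObjPreimageIso Y) ?_
  set Z := L.objPreimage Y
  -- Morphisms into objects of the right orthogonal are the same in `C` and in the quotient.
  have hb : Function.Bijective (DirectSum.map (fun i => (L.mapAddHom : (Z ⟶ X i) →+ _))) := by
    have hi := fun i => (hX i).map_bijective_of_isTriangulated L Z
    exact ⟨(DirectSum.map_injective _).2 fun i => (hi i).1,
      (DirectSum.map_surjective _).2 fun i => (hi i).2⟩
  refine (Function.Bijective.of_comp_iff _ hb).1 ?_
  convert h Z
  ext x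
  exact yonedaSum_comp F L X ε Z x

lemma IsLocallyNoetherian.of_isLocalization (P : ObjectProperty C) [P.IsTriangulated]
    (L : C ⥤ D) [L.CommShift ℤ] [L.IsTriangulated] [L.IsLocalization P.trW]
    (hC : IsLocallyNoetherian.{w} C) :
    IsLocallyNoetherian.{w} D := fun F _ => by
  obtain ⟨I, X, ε, -, h⟩ := hC.exists_bijective_yonedaSum_of_isLocalization P L F
  exact isDirectSumOfRepresentables_of_bijective_yonedaSum F _ ε h

end Localization

/-- The constructed localization of a small category is small, so it suffices to replace `C` by a
small model. -/
lemma CategoryTheory.MorphismProperty.essentiallySmall_of_isLocalization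
    {C : Type u} [Category.{v} C] [EssentiallySmall.{w} C]
    {D : Type u'} [Category.{v'} D] (W : MorphismProperty C) [W.RespectsIso] (L : C ⥤ D)
    [L.IsLocalization W] : EssentiallySmall.{w} D := by
  let E := equivSmallModel.{w} C
  let W' := W.inverseImage E.inverse
  have : (E.inverse ⋙ L).IsLocalization W' := by
    refine Functor.IsLocalization.of_equivalence_source L W _ W' E ?_ ?_
      ((Functor.associator _ _ _).symm ≪≫ Functor.isoWhiskerRight E.unitIso.symm _ ≪≫
        L.leftUnitor)
    · intro X Y f hf
      refine MorphismProperty.le_isoClosure _ _ ?_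
      exact (W.arrow_mk_iso_iff (((Functor.mapArrowFunctor _ _).mapIso E.unitIso).app
        (CategoryTheory.Arrow.mk f))).1 hf
    · intro X Y f hf
      exact Localization.inverts L W _ hf
  exact EssentiallySmall.mk' (Localization.uniq (E.inverse ⋙ L) W'.Q W')

/-! ### Representable functors that decompose -/

section ShrinkYoneda

variable {C : Type u} [Category.{v} C] [Preadditive C] [LocallySmall.{w} C]

/-- The functor represented by `Z`, with values in the groups of a universe in which `C` is
locally small. -/
noncomputable def shrinkPreadditiveYoneda (Z : C) : Cᵒᵖ ⥤ AddCommGrpCat.{w} where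
  obj Y := AddCommGrpCat.of (Shrink.{w} (Y.unop ⟶ Z))
  map f := AddCommGrpCat.ofHom
    ((Shrink.addEquiv.symm.toAddMonoidHom.comp (Preadditive.leftComp Z f.unop)).comp
      Shrink.addEquiv.toAddMonoidHom)
  map_id X := by ext x; simp
  map_comp f g := by ext x; simp

/-- The values of `shrinkPreadditiveYoneda Z` are the groups of morphisms to `Z`. -/
noncomputable def shrinkPreadditiveYonedaEquiv {Y : Cᵒᵖ} {Z : C} :
    (shrinkPreadditiveYoneda.{w} Z).obj Y ≃+ (Y.unop ⟶ Z) :=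
  Shrink.addEquiv

@[simp]
lemma shrinkPreadditiveYonedaEquiv_map {Z : C} {X Y : Cᵒᵖ} (f : X ⟶ Y)
    (x : (shrinkPreadditiveYoneda.{w} Z).obj X) :
    shrinkPreadditiveYonedaEquiv ((shrinkPreadditiveYoneda.{w} Z).map f x) =
      f.unop ≫ shrinkPreadditiveYonedaEquiv x :=
  Shrink.addEquiv.apply_symm_apply _

end ShrinkYoneda

/-- If a representable functor is a direct sum of representable functors, then the representing
object is a finite direct sum of some of the objects representing the summands. -/
lemma exists_iso_map_biproduct_of_bijective_yonedaSum {C : Type u} [Category.{v} C]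
    [Preadditive C] [HasFiniteBiproducts C] {D : Type u'} [Category.{v'} D] [Preadditive D]
    [LocallySmall.{w} D] (L : C ⥤ D) [L.Additive] {I : Type w} (Z : I → C) (W : D)
    [(shrinkPreadditiveYoneda.{w} W).Additive]
    (ε : ∀ i, (shrinkPreadditiveYoneda.{w} W).obj (op (L.obj (Z i))))
    (h : ∀ Y, Function.Bijective
      (yonedaSum (shrinkPreadditiveYoneda.{w} W) (fun i => L.obj (Z i)) ε Y)) :
    ∃ s : Finset I, Nonempty (W ≅ L.obj (⨁ fun i : s => Z i)) := by
  classical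
  -- The finite support of `x` selects the summands, and its components give a section `a` of `b`.
  obtain ⟨x, hx⟩ := (h W).2 (shrinkPreadditiveYonedaEquiv.symm (𝟙 W))
  let δ : ∀ i, L.obj (Z i) ⟶ W := fun i => shrinkPreadditiveYonedaEquiv (ε i)
  have key : ∀ (Y : D) (y : ⨁ i, (Y ⟶ L.obj (Z i))) (s : Finset I),
      y.support ⊆ s → shrinkPreadditiveYonedaEquiv
        (yonedaSum (shrinkPreadditiveYoneda.{w} W) (fun i => L.obj (Z i)) ε Y y) =
          ∑ i ∈ s, y i ≫ δ i := by
    intro Y y s hs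
    conv_lhs => rw [← DirectSum.sum_support_of y]
    simp only [map_sum, yonedaSum_of]
    rw [Finset.sum_subset hs]
    · exact Finset.sum_congr rfl fun i _ => shrinkPreadditiveYonedaEquiv_map _ _
    · intro i _ hi
      have hi' : y i = 0 := by simpa using hi
      simp [hi']
  let s := x.support
  let B : C := ⨁ fun i : s => Z i
  let a : W ⟶ L.obj B := ∑ i : s, x i ≫ L.map (biproduct.ι (fun i : s => Z i) i)
  let b : L.obj B ⟶ W := ∑ i : s, L.map (biproduct.π (fun i : s => Z i) i) ≫ δ i
  have hπι : ∑ i : s, L.map (biproduct.π (fun i : s => Z i) i) ≫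
      L.map (biproduct.ι (fun i : s => Z i) i) = 𝟙 (L.obj B) := by
    simp only [← L.map_comp, ← L.map_sum]
    exact (congr_arg L.map (IsBilimit.total (biproduct.isBilimit fun i : s => Z i))).trans
      (L.map_id _)
  have hιπ : ∀ i j : s, L.map (biproduct.ι (fun i : s => Z i) i) ≫
      L.map (biproduct.π (fun i : s => Z i) j) ≫ δ j = if i = j then δ i else 0 := by
    intro i j
    rw [← L.map_comp_assoc]
    split_ifs with hij
    · subst hij
      simp
    · rw [biproduct.ι_π_ne _ hij]
      simp
  have hab : a ≫ b = 𝟙 _ := by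
    have := key _ x s subset_rfl
    rw [hx, AddEquiv.apply_symm_apply] at this
    rw [this, ← Finset.sum_coe_sort s (fun i => x i ≫ δ i)]
    simp only [a, b, Preadditive.sum_comp, Preadditive.comp_sum, Category.assoc, hιπ]
    refine Finset.sum_congr rfl fun j _ => (Finset.sum_eq_single j (fun i _ hij => ?_) ?_).trans
      (by rw [if_pos rfl])
    · rw [if_neg hij, comp_zero]
    · simp
  -- The components of `y` form an element of the direct sum supported in `s`, whose image is `y ≫
  -- b`; injectivity in `h` then kills it.
  have hb : ∀ (Y : D) (y : Y ⟶ L.obj B), y ≫ b = 0 → y = 0 := by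
    intro Y y hy
    obtain ⟨z, hzi, hzs⟩ : ∃ z : ⨁ i, (Y ⟶ L.obj (Z i)),
        (∀ i : s, z i = y ≫ L.map (biproduct.π (fun i : s => Z i) i)) ∧ z.support ⊆ s := by
      refine ⟨DirectSum.mk (fun i => (Y ⟶ L.obj (Z i))) s
        fun i => y ≫ L.map (biproduct.π (fun i : s => Z i) ⟨i.1, i.2⟩),
        fun i => DirectSum.mk_apply_of_mem (β := fun i => (Y ⟶ L.obj (Z i))) i.2, fun i hi => ?_⟩
      by_contra hn
      exact DFinsupp.mem_support_iff.1 hi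
        (DirectSum.mk_apply_of_notMem (β := fun i => (Y ⟶ L.obj (Z i))) hn)
    have hz : z = 0 := by
      apply (h Y).1
      apply shrinkPreadditiveYonedaEquiv.injective
      refine (key Y z s hzs).trans ?_
      rw [← Finset.sum_coe_sort s (fun i => z i ≫ δ i), map_zero, map_zero, ← hy]
      simp only [hzi, b, Preadditive.comp_sum, Category.assoc]
    have hz' : ∀ i : s, y ≫ L.map (biproduct.π (fun i : s => Z i) i) = 0 := by
      intro i
      rw [← hzi, hz, DirectSum.zero_apply]
    rw [← Category.comp_id y, ← hπι, Preadditive.comp_sum]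
    exact Finset.sum_eq_zero fun i _ => by rw [reassoc_of% hz' i, zero_comp]
  have : Mono b := Preadditive.mono_of_cancel_zero _ (hb _)
  have : IsSplitEpi b := ⟨⟨a, hab⟩⟩
  have : IsIso b := isIso_of_mono_of_isSplitEpi b
  exact ⟨s, ⟨(asIso b).symm⟩⟩

/-! ### Kernels of quotient functors and reflections -/

variable {C : Type u} [Category.{v} C] [HasZeroObject C] [HasShift C ℤ]
  [Preadditive C] [∀ n : ℤ, (shiftFunctor C n).Additive] [Pretriangulated C]

instance [LocallySmall.{w} C] (Z : C) : (shrinkPreadditiveYoneda.{w} Z).IsHomological where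
  map_zero X Y := by
    ext x
    apply shrinkPreadditiveYonedaEquiv.injective
    rw [shrinkPreadditiveYonedaEquiv_map]
    simp
  exact T hT := by
    rw [ShortComplex.ab_exact_iff]
    intro (x : (shrinkPreadditiveYoneda.{w} Z).obj T.obj₂)
      (hx : (shrinkPreadditiveYoneda.{w} Z).map T.mor₂ x = 0)
    have hx' : T.mor₂.unop ≫ shrinkPreadditiveYonedaEquiv x = 0 := by
      rw [← shrinkPreadditiveYonedaEquiv_map, hx, map_zero]
    obtain ⟨y, hy⟩ := Triangle.yoneda_exact₂ _ (unop_distinguished T hT) _ hx'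
    refine ⟨shrinkPreadditiveYonedaEquiv.symm y, shrinkPreadditiveYonedaEquiv.injective ?_⟩
    refine (shrinkPreadditiveYonedaEquiv_map T.mor₁ _).trans (Eq.trans ?_ hy.symm)
    exact congr_arg (T.mor₁.unop ≫ ·) (shrinkPreadditiveYonedaEquiv.apply_symm_apply _)

/-- If `LX = 0`, some `s : X ⟶ Z` in `P.trW` equalizes the identity and zero, so `s = 0`. In the
triangle `A → X → Z →` with `A` in `P`, the identity of `X` then factors through `A`. -/
lemma CategoryTheory.ObjectProperty.prop_of_isZero_map {D : Type u'} [Category.{v'} D]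
    [IsTriangulated C] (P : ObjectProperty C) [P.IsTriangulated] [P.IsStableUnderRetracts]
    (L : C ⥤ D) [L.IsLocalization P.trW] {X : C} (h : IsZero (L.obj X)) : P X := by
  obtain ⟨Z, s, hs, h0⟩ := (MorphismProperty.map_eq_iff_postcomp L P.trW (𝟙 X) 0).1
    (h.eq_of_src _ _)
  rw [P.trW_iff'] at hs
  obtain ⟨A, f, g, hT, hA⟩ := hs
  obtain ⟨φ, hφ⟩ := Triangle.coyoneda_exact₂ _ hT (𝟙 X) (by rwa [zero_comp] at h0)
  exact P.prop_of_retract ⟨φ, f, hφ.symm⟩ hA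

variable {D : Type u'} [Category.{v'} D] [HasZeroObject D] [HasShift D ℤ]
  [Preadditive D] [∀ n : ℤ, (shiftFunctor D n).Additive] [Pretriangulated D]

lemma CategoryTheory.ObjectProperty.trW_of_isIso_map [IsTriangulated C]
    (P : ObjectProperty C) [P.IsTriangulated] [P.IsStableUnderRetracts]
    (L : C ⥤ D) [L.CommShift ℤ] [L.IsTriangulated] [L.IsLocalization P.trW] {X Y : C}
    (f : X ⟶ Y) (h : IsIso (L.map f)) : P.trW f := by
  obtain ⟨Z, g, h', hT⟩ := distinguished_cocone_triangle f
  refine ⟨Z, g, h', hT, P.prop_of_isZero_map L ?_⟩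
  exact Triangle.isZero₃_of_isIso₁ _ (L.map_distinguished _ hT) h

/-- In a locally noetherian category, every object `X` has a reflection in the right orthogonal
of a thick subcategory. -/
lemma IsLocallyNoetherian.exists_trW_rightOrthogonal [IsTriangulated C] [EssentiallySmall.{w} C]
    (hC : IsLocallyNoetherian.{w} C) (P : ObjectProperty C) [P.IsTriangulated]
    [P.IsStableUnderRetracts] (X : C) :
    ∃ (X' : C) (g : X ⟶ X'), P.rightOrthogonal X' ∧ P.trW g := by
  let L := P.trW.Q
  have : EssentiallySmall.{w} P.trW.Localization :=
    P.trW.essentiallySmall_of_isLocalization L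
  obtain ⟨I, Z, ε, hZ, h⟩ := hC.exists_bijective_yonedaSum_of_isLocalization P L
    (shrinkPreadditiveYoneda.{w} (L.obj X))
  obtain ⟨s, ⟨e⟩⟩ := exists_iso_map_biproduct_of_bijective_yonedaSum L Z (L.obj X) ε h
  have hB : P.rightOrthogonal (⨁ fun i : s => Z i) := by
    intro A f hA
    refine biproduct.hom_ext _ _ fun i => ?_
    exact (hZ i (f ≫ biproduct.π _ i) hA).trans zero_comp.symm
  -- The target is in the right orthogonal, so the isomorphism in the quotient lifts to `C`.
  obtain ⟨g, hg⟩ := (hB.map_bijective_of_isTriangulated L X).2 e.hom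
  exact ⟨_, g, hB, P.trW_of_isIso_map L g (by rw [hg]; infer_instance)⟩

end

/-! ### Double orthogonals and local finiteness of thick subcategories -/

section OrthogonalSubcategories

open Opposite
open scoped ZeroObject CategoryTheory.Pretriangulated.Opposite

variable {C : Type u} [Category.{v} C] [HasZeroObject C] [HasShift C ℤ]
  [Preadditive C] [∀ n : ℤ, (shiftFunctor C n).Additive] [Pretriangulated C]

instance (P : ObjectProperty C) [P.IsStableUnderRetracts] : P.op.IsStableUnderRetracts where
  of_retract r h := P.prop_of_retract ⟨r.r.unop, r.i.unop, Quiver.Hom.op_inj r.retract⟩ h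

instance (P : ObjectProperty C) : P.leftOrthogonal.IsStableUnderRetracts where
  of_retract r h Y f hY := by
    rw [← Category.id_comp f, ← r.retract, Category.assoc, h (r.r ≫ f) hY, comp_zero]

section

variable [IsTriangulated C] [EssentiallySmall.{w} C]

/-- If the opposite category is locally noetherian, every object `X` has a coreflection in the
left orthogonal of a thick subcategory. -/
lemma IsLocallyNoetherian.exists_trW_leftOrthogonal
    (hC : IsLocallyNoetherian.{w} Cᵒᵖ) (P : ObjectProperty C) [P.IsTriangulated]
    [P.IsStableUnderRetracts] (X : C) :
    ∃ (X' : C) (g : X' ⟶ X), P.leftOrthogonal X' ∧ P.trW g := by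
  obtain ⟨X', g, h₁, h₂⟩ := hC.exists_trW_rightOrthogonal P.op (op X)
  refine ⟨X'.unop, g.unop, fun Y f hY => ?_, P.trW_op_iff.1 h₂⟩
  exact Quiver.Hom.op_inj (h₁ f.op hY)

/-- In the triangle `A → X → X' →`, the second map vanishes when `X` is in the left orthogonal of
`P^⊥`, which makes `X` a retract of `A`. -/
lemma IsLocallyNoetherian.leftOrthogonal_rightOrthogonal
    (hC : IsLocallyNoetherian.{w} C) (P : ObjectProperty C) [P.IsTriangulated]
    [P.IsStableUnderRetracts] : P.rightOrthogonal.leftOrthogonal = P := by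
  refine le_antisymm (fun X hX => ?_) fun X hX Y f hY => hY f hX
  obtain ⟨X', g, h₁, h₂⟩ := hC.exists_trW_rightOrthogonal P X
  rw [P.trW_iff'] at h₂
  obtain ⟨A, f, h, hT, hA⟩ := h₂
  obtain ⟨φ, hφ⟩ := Triangle.coyoneda_exact₂ _ hT (𝟙 X) ((Category.id_comp g).trans (hX g h₁))
  exact P.prop_of_retract ⟨φ, f, hφ.symm⟩ hA

lemma IsLocallyNoetherian.rightOrthogonal_leftOrthogonal
    (hC : IsLocallyNoetherian.{w} Cᵒᵖ) (P : ObjectProperty C) [P.IsTriangulated]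
    [P.IsStableUnderRetracts] : P.leftOrthogonal.rightOrthogonal = P := by
  refine le_antisymm (fun X hX => ?_) fun X hX Y f hY => hY f hX
  obtain ⟨X', g, h₁, A, f, h, hT, hA⟩ := hC.exists_trW_leftOrthogonal P X
  obtain ⟨φ, hφ⟩ := Triangle.yoneda_exact₂ _ hT (𝟙 X) ((Category.comp_id g).trans (hX g h₁))
  exact P.prop_of_retract ⟨f, φ, hφ.symm⟩ hA

end

/-- If every object `X` admits a morphism to an object of `P` with cone in the left orthogonal of
`P`, then the inclusion of `P` has a left adjoint, which is a localization functor. -/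
lemma CategoryTheory.ObjectProperty.exists_isLocalization_leftOrthogonal (P : ObjectProperty C)
    [P.IsTriangulated] [P.IsClosedUnderIsomorphisms]
    (h : ∀ X, ∃ (X' : C) (g : X ⟶ X'), P X' ∧ P.leftOrthogonal.trW g) :
    ∃ (L : C ⥤ P.FullSubcategory) (_ : L.CommShift ℤ),
      L.IsTriangulated ∧ L.IsLocalization P.leftOrthogonal.trW := by
  choose X' g hX' hg using h
  have hloc : ∀ {X Y : C} (f : X ⟶ Y), P.leftOrthogonal.trW f → ∀ Z : P.FullSubcategory,
      Function.Bijective fun φ : Y ⟶ Z.obj => f ≫ φ := fun f hf Z => by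
    have : P.leftOrthogonal.trW.isLocal Z.obj := by
      rw [ObjectProperty.isLocal_trW]
      exact fun X f hX => hX f Z.property
    exact this f hf
  let e : ∀ (X : C) (Y : P.FullSubcategory),
      ((⟨X' X, hX' X⟩ : P.FullSubcategory) ⟶ Y) ≃ (X ⟶ P.ι.obj Y) := fun X Y =>
    P.fullyFaithfulι.homEquiv.trans (Equiv.ofBijective _ (hloc (g X) (hg X) Y))
  let L := Adjunction.leftAdjointOfEquiv (G := P.ι) e (fun X Y Y' f k => by
    simp [e, Functor.FullyFaithful.homEquiv])
  let adj : L ⊣ P.ι := Adjunction.adjunctionOfEquivLeft e _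
  let _ : L.CommShift ℤ := adj.leftAdjointCommShift ℤ
  have _ : adj.CommShift ℤ := adj.commShift_of_rightAdjoint ℤ
  -- A left adjoint of a fully faithful functor is a localization at any class that it inverts and
  -- that contains the units.
  refine ⟨L, inferInstance, adj.isTriangulated_leftAdjoint,
    adj.isLocalization_leftAdjoint _ ?_ ?_⟩
  · intro X Y f hf
    refine isIso_of_coyoneda_map_bijective _ fun Z => ?_
    have h₁ := hloc f hf Z
    have h₂ : (fun φ : L.obj Y ⟶ Z => L.map f ≫ φ) =
        (adj.homEquiv X Z).symm ∘ (fun φ : Y ⟶ Z.obj => f ≫ φ) ∘ adj.homEquiv Y Z := by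
      ext φ : 1
      simp [Equiv.eq_symm_apply, adj.homEquiv_naturality_left]
    rw [h₂]
    exact (Equiv.bijective _).comp (h₁.comp (Equiv.bijective _))
  · intro X
    have : adj.unit.app X = g X := by
      simp only [adj, Adjunction.adjunctionOfEquivLeft, Adjunction.mkOfHomEquiv_unit_app, e,
        Functor.FullyFaithful.homEquiv]
      exact Category.comp_id (g X)
    rw [this]
    exact hg X

variable [IsTriangulated C]

lemma IsLocallyFinite.of_isLocalization {D : Type*} [Category* D] [HasZeroObject D] [HasShift D ℤ]
    [Preadditive D] [∀ n : ℤ, (shiftFunctor D n).Additive] [Pretriangulated D] [IsTriangulated D]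
    (hC : IsLocallyFinite.{w} C) (P : ObjectProperty C) [P.IsTriangulated] (L : C ⥤ D)
    [L.CommShift ℤ] [L.IsTriangulated] [L.IsLocalization P.trW] : IsLocallyFinite.{w} D where
  essentiallySmall :=
    have := hC.essentiallySmall
    P.trW.essentiallySmall_of_isLocalization L
  locallyNoetherian := hC.locallyNoetherian.of_isLocalization P L
  locallyNoetherian_op :=
    have : L.op.IsLocalization P.op.trW := by rw [P.trW_op]; infer_instance
    hC.locallyNoetherian_op.of_isLocalization P.op L.op

/-- Since `P = (^⊥P)^⊥`, reflections into `P` exist with cones in `^⊥P`, and `P` is equivalent to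
the Verdier quotient `C/^⊥P`. -/
lemma IsLocallyFinite.fullSubcategory (hC : IsLocallyFinite.{w} C) (P : ObjectProperty C)
    [P.IsTriangulated] [P.IsStableUnderRetracts] : IsLocallyFinite.{w} P.FullSubcategory := by
  have := hC.essentiallySmall
  obtain ⟨L, _, _, _⟩ := P.exists_isLocalization_leftOrthogonal fun X => by
    obtain ⟨X', g, h₁, h₂⟩ := hC.locallyNoetherian.exists_trW_rightOrthogonal P.leftOrthogonal X
    rw [hC.locallyNoetherian_op.rightOrthogonal_leftOrthogonal P] at h₁
    exact ⟨X', g, h₁, h₂⟩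
  exact hC.of_isLocalization P.leftOrthogonal L

end OrthogonalSubcategories

/-! ### Thick subcategories of Verdier quotients -/

namespace ThickSubcategory

open scoped ZeroObject

variable {C : Type u} [Category.{v} C] [HasZeroObject C] [HasShift C ℤ]
  [Preadditive C] [∀ n : ℤ, (shiftFunctor C n).Additive] [Pretriangulated C]

lemma restrict_mono {V X : ThickSubcategory C} (h : V ≤ X) (U : ThickSubcategory C) :
    V.restrict U ≤ X.restrict U := fun _ hY => h _ hY

/-- A morphism from `V` to `X` must factor through an object in both; its source serves. This yields
full faithfulness of `X/V → C/V`. -/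
lemma isVerdierRightLocalizing {V X : ThickSubcategory C} (h : V ≤ X) : X.obj.IsVerdierRightLocalizing V.obj where
  fac {A _} f hA _ := ⟨A, 𝟙 A, f, h A hA, hA, Category.id_comp f⟩

lemma rightPerp_anti {U V : ThickSubcategory C} (h : U ≤ V) : V.rightPerp ≤ U.rightPerp :=
  fun _ hY _ f hX => hY f (h _ hX)

lemma leftPerp_anti {U V : ThickSubcategory C} (h : U ≤ V) : V.leftPerp ≤ U.leftPerp :=
  fun _ hX _ f hY => hX f (h _ hY)

lemma inf_rightPerp (U : ThickSubcategory C) : U ⊓ U.rightPerp = ⊥ :=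
  le_bot_iff.1 fun X hX => (IsZero.iff_id_eq_zero X).2 (hX.2 (𝟙 X) hX.1)

variable [IsTriangulated C]

/-- As `P ≤ R`, the quotient `C → C/R` factors through `L`. There `Y` becomes zero, hence so does
its retract `X`, and the kernel is `R`. -/
lemma obj_of_retract_map {P R : ThickSubcategory C} (hPR : P ≤ R) {D : Type*} [Category* D]
    (L : C ⥤ D) [L.IsLocalization P.obj.trW] {X Y : C} (r : Retract (L.obj X) (L.obj Y))
    (hY : R.obj Y) : R.obj X := by
  let M := R.obj.trW.Q
  have hM : P.obj.trW.IsInvertedBy M := fun _ _ f hf =>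
    Localization.inverts M R.obj.trW f (ObjectProperty.trW_monotone hPR f hf)
  let M' := Localization.lift M hM L
  let e : L ⋙ M' ≅ M := Localization.fac M hM L
  have h₁ : IsZero (M'.obj (L.obj Y)) :=
    (R.obj.isZero_of_isLocalization_trW M hY).of_iso (e.app Y)
  have r' := r.map M'
  have h₂ : IsZero (M'.obj (L.obj X)) := by
    rw [IsZero.iff_id_eq_zero, ← r'.retract, h₁.eq_of_tgt r'.i 0, zero_comp]
  exact R.obj.prop_of_isZero_map M (h₂.of_iso (e.app X).symm)

/-- The image in the Verdier quotient `C / P` of a thick subcategory containing `P`. -/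
def image (P R : ThickSubcategory C) (hPR : P ≤ R) : ThickSubcategory P.VerdierQuotient where
  obj := R.obj.map P.obj.trW.Q
  isTriangulated :=
    { exists_zero := ⟨_, P.obj.trW.Q.map_isZero (isZero_zero C),
        ⟨0, R.obj.prop_zero, ⟨Iso.refl _⟩⟩⟩
      isStableUnderShiftBy := fun n => ⟨fun Z hZ => by
        obtain ⟨Y, hY, ⟨e⟩⟩ := hZ
        exact ⟨Y⟦n⟧, R.obj.le_shift n _ hY,
          ⟨(P.obj.trW.Q.commShiftIso n).app Y ≪≫ (shiftFunctor _ n).mapIso e⟩⟩⟩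
      ext₂' := fun T hT h₁ h₃ => ObjectProperty.le_isoClosure _ _ (by
        obtain ⟨Y₁, hY₁, ⟨e₁⟩⟩ := h₁
        obtain ⟨Y₃, hY₃, ⟨e₃⟩⟩ := h₃
        -- Triangles of the quotient come from `C` up to isomorphism; the outer terms of `T'` lie in
        -- `R`, hence so does the middle one.
        obtain ⟨T', e, hT'⟩ := hT
        refine ⟨T'.obj₂,
          R.obj.ext_of_isTriangulatedClosed₂ T' hT'
            (obj_of_retract_map hPR P.obj.trW.Q
              ((Triangle.π₁.mapIso e).symm ≪≫ e₁.symm).retract hY₁)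
            (obj_of_retract_map hPR P.obj.trW.Q
              ((Triangle.π₃.mapIso e).symm ≪≫ e₃.symm).retract hY₃),
          ⟨(Triangle.π₂.mapIso e).symm⟩⟩) }
  isStableUnderRetracts :=
    { of_retract := fun {Z W} r h => by
        obtain ⟨Y, hY, ⟨e⟩⟩ := h
        have := Localization.essSurj P.obj.trW.Q P.obj.trW
        let i := P.obj.trW.Q.objObjPreimageIso Z
        exact ⟨_, obj_of_retract_map hPR P.obj.trW.Q
          ((Retract.ofIso i).trans (r.trans (Retract.ofIso e.symm))) hY, ⟨i⟩⟩ }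

lemma image_obj_map_iff {P R : ThickSubcategory C} (hPR : P ≤ R) (X : C) :
    (image P R hPR).obj (P.obj.trW.Q.obj X) ↔ R.obj X := by
  refine ⟨fun h => ?_, fun h => ⟨X, h, ⟨Iso.refl _⟩⟩⟩
  obtain ⟨Y, hY, ⟨e⟩⟩ := h
  exact obj_of_retract_map hPR P.obj.trW.Q (Retract.ofIso e.symm) hY

/-- The preimage in `C` of a thick subcategory of `U / V`. -/
def preimage (U V : ThickSubcategory C) (S : ThickSubcategory (SubQuotient U V)) :
    ThickSubcategory C where
  obj X := ∃ h : U.obj X, S.obj ((V.restrict U).obj.trW.Q.obj ⟨X, h⟩)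
  isTriangulated := by
    have h : (fun X => ∃ h : U.obj X, S.obj ((V.restrict U).obj.trW.Q.obj ⟨X, h⟩)) =
        (S.obj.inverseImage (V.restrict U).obj.trW.Q).map U.obj.ι := by
      ext X
      rw [ObjectProperty.prop_map_iff]
      constructor
      · rintro ⟨h₁, h₂⟩
        exact ⟨⟨X, h₁⟩, h₂, ⟨Iso.refl _⟩⟩
      · rintro ⟨Y, hY, ⟨e⟩⟩
        have hX : U.obj X := U.obj.prop_of_iso e Y.property
        let e' : Y ≅ (⟨X, hX⟩ : U.Carrier) := U.obj.ι.preimageIso e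
        exact ⟨hX, S.obj.prop_of_iso ((V.restrict U).obj.trW.Q.mapIso e') hY⟩
    rw [h]
    infer_instance
  isStableUnderRetracts :=
    { of_retract := fun {X Y} r h => by
        obtain ⟨h₁, h₂⟩ := h
        have hX := U.obj.prop_of_retract r h₁
        let r' : Retract (⟨X, hX⟩ : U.Carrier) ⟨Y, h₁⟩ :=
          ⟨U.obj.homMk r.i, U.obj.homMk r.r, by ext; exact r.retract⟩
        exact ⟨hX, S.obj.prop_of_retract (r'.map _) h₂⟩ }

/-- For thick subcategories `V ≤ U`, the order isomorphism between the interval `[V, U]` and the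
lattice of thick subcategories of `U / V`. -/
noncomputable def intervalOrderIso {V U : ThickSubcategory C} (hVU : V ≤ U) :
    Set.Icc V U ≃o ThickSubcategory (SubQuotient U V) :=
  RelIso.ofSurjective
    (OrderEmbedding.ofMapLEIff
      (fun X => image (V.restrict U) (X.1.restrict U) (restrict_mono X.2.1 U))
      (fun X X' => by
        constructor
        · intro h Y hY
          have hY' : U.obj Y := X.2.2 Y hY
          exact (image_obj_map_iff (restrict_mono X'.2.1 U) ⟨Y, hY'⟩).1
            (h _ ((image_obj_map_iff (restrict_mono X.2.1 U) ⟨Y, hY'⟩).2 hY))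
        · intro h Z hZ
          obtain ⟨Y, hY, e⟩ := hZ
          exact ⟨Y, h _ hY, e⟩))
    (fun S => by
      let Q := (V.restrict U).obj.trW.Q
      refine ⟨⟨preimage U V S, fun Y hY => ⟨hVU Y hY, S.obj.prop_of_isZero
        ((V.restrict U).obj.isZero_of_isLocalization_trW Q hY)⟩, fun Y hY => hY.1⟩, ?_⟩
      ext Z
      constructor
      · intro hZ
        obtain ⟨Y, hY, ⟨e⟩⟩ := hZ
        exact S.obj.prop_of_iso e hY.2
      · intro hZ
        have := Localization.essSurj Q (V.restrict U).obj.trW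
        let i := Q.objObjPreimageIso Z
        exact ⟨Q.objPreimage Z,
          ⟨(Q.objPreimage Z).property, S.obj.prop_of_iso i.symm hZ⟩, ⟨i⟩⟩)

/-! ### Full faithfulness and image of the canonical functor -/

section

variable {V X U : ThickSubcategory C}

/-- The canonical functor `X / V ⥤ U / V` commutes with the quotient functors. -/
noncomputable def quotientFunctorFac (h : X ≤ U) (V : ThickSubcategory C) :
    (V.restrict X).obj.trW.Q ⋙ quotientFunctor h V ≅
      ObjectProperty.ιOfLE h ⋙ (V.restrict U).obj.trW.Q :=
  Localization.fac _ _ _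

/-- Both `U/V → C/V` and the composite `X/V → U/V → C/V` are fully faithful, so the first factor is
too. -/
lemma nonempty_fullyFaithful_quotientFunctor (hVX : V ≤ X) (hXU : X ≤ U) :
    Nonempty (quotientFunctor hXU V).FullyFaithful := by
  have := isVerdierRightLocalizing hVX
  have := isVerdierRightLocalizing (hVX.trans hXU)
  let Φ := U.obj.triangulatedLocalizerMorphism V.obj
  let LU := (V.restrict U).obj.trW.Q
  have : LU.IsLocalization (V.obj.inverseImage U.obj.ι).trW :=
    inferInstanceAs (LU.IsLocalization (V.restrict U).obj.trW)
  let LX := (V.restrict X).obj.trW.Q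
  have : LX.IsLocalization (V.obj.inverseImage X.obj.ι).trW :=
    inferInstanceAs (LX.IsLocalization (V.restrict X).obj.trW)
  let G := Φ.localizedFunctor LU V.obj.trW.Q
  let eG : LU ⋙ G ≅ U.obj.ι ⋙ V.obj.trW.Q :=
    (CatCommSq.iso Φ.functor LU V.obj.trW.Q G).symm
  have e : LX ⋙ (quotientFunctor hXU V ⋙ G) ≅ X.obj.ι ⋙ V.obj.trW.Q :=
    (Functor.associator _ _ _).symm ≪≫
      Functor.isoWhiskerRight (quotientFunctorFac hXU V) G ≪≫ Functor.associator _ _ _ ≪≫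
      Functor.isoWhiskerLeft (ObjectProperty.ιOfLE hXU) eG
  have hG : G.FullyFaithful := ObjectProperty.IsVerdierRightLocalizing.fullyFaithful
    (A := U.obj) (B := V.obj) eG
  have hc : (quotientFunctor hXU V ⋙ G).FullyFaithful :=
    ObjectProperty.IsVerdierRightLocalizing.fullyFaithful
      (A := X.obj) (B := V.obj) e
  have := hG.faithful
  exact ⟨Functor.FullyFaithful.ofCompFaithful hc⟩

lemma essImage_quotientFunctor (hVU : V ≤ U) (I : Set.Icc V U) :
    (quotientFunctor I.2.2 V).essImage = (intervalOrderIso hVU I).obj := by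
  ext Z
  constructor
  · rintro ⟨W, ⟨e⟩⟩
    have := Localization.essSurj (V.restrict I.1).obj.trW.Q (V.restrict I.1).obj.trW
    let i := (V.restrict I.1).obj.trW.Q.objObjPreimageIso W
    let Y := (V.restrict I.1).obj.trW.Q.objPreimage W
    exact ⟨(ObjectProperty.ιOfLE I.2.2).obj Y, Y.property,
      ⟨(quotientFunctorFac I.2.2 V).symm.app _ ≪≫ (quotientFunctor I.2.2 V).mapIso i ≪≫ e⟩⟩
  · intro hZ
    obtain ⟨Y, hY, ⟨e⟩⟩ := hZ
    exact ⟨(V.restrict I.1).obj.trW.Q.obj ⟨Y.obj, hY⟩,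
      ⟨(quotientFunctorFac I.2.2 V).app ⟨Y.obj, hY⟩ ≪≫ e⟩⟩

end

/-! ### Orthogonals in the lattice of thick subcategories -/

section LocallyFinite

lemma leftPerp_rightPerp (hC : IsLocallyFinite.{w} C) (U : ThickSubcategory C) :
    U.rightPerp.leftPerp = U :=
  have := hC.essentiallySmall
  ThickSubcategory.ext (hC.locallyNoetherian.leftOrthogonal_rightOrthogonal U.obj)

lemma rightPerp_leftPerp (hC : IsLocallyFinite.{w} C) (U : ThickSubcategory C) :
    U.leftPerp.rightPerp = U :=
  have := hC.essentiallySmall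
  ThickSubcategory.ext (hC.locallyNoetherian_op.rightOrthogonal_leftOrthogonal U.obj)

/-- Taking orthogonals is an anti-automorphism of the lattice of thick subcategories of a locally
finite triangulated category. -/
def perpOrderIso (hC : IsLocallyFinite.{w} C) :
    ThickSubcategory C ≃o (ThickSubcategory C)ᵒᵈ where
  toFun U := OrderDual.toDual U.rightPerp
  invFun U := (OrderDual.ofDual U).leftPerp
  left_inv U := leftPerp_rightPerp hC U
  right_inv U := congr_arg OrderDual.toDual (rightPerp_leftPerp hC (OrderDual.ofDual U))
  map_rel_iff' {U V} := by
    refine ⟨fun h => ?_, fun h => rightPerp_anti h⟩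
    have := leftPerp_anti (show V.rightPerp ≤ U.rightPerp from h)
    rwa [leftPerp_rightPerp hC, leftPerp_rightPerp hC] at this

lemma sup_rightPerp (hC : IsLocallyFinite.{w} C) (U : ThickSubcategory C) :
    U ⊔ U.rightPerp = ⊤ := by
  have := hC.essentiallySmall
  refine top_le_iff.1 fun X _ => ?_
  obtain ⟨X', g, h₁, h₂⟩ := hC.locallyNoetherian.exists_trW_rightOrthogonal U.obj X
  rw [U.obj.trW_iff'] at h₂
  obtain ⟨A, f, h, hT, hA⟩ := h₂
  exact (U ⊔ U.rightPerp).obj.ext_of_isTriangulatedClosed₂ _ hT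
    ((le_sup_left : U ≤ U ⊔ U.rightPerp) A hA)
    ((le_sup_right : U.rightPerp ≤ U ⊔ U.rightPerp) X' h₁)

end LocallyFinite

end ThickSubcategory

theorem proposition4p3 {T : Type u} [Category.{v} T] [HasZeroObject T] [HasShift T ℤ]
    [Preadditive T] [∀ n : ℤ, (shiftFunctor T n).Additive] [Pretriangulated T] [IsTriangulated T]
    (hT : IsLocallyFinite.{w} T) :
    -- (1) the two maps are mutually inverse, and they are anti-automorphisms of the lattice
    ((∀ U : ThickSubcategory T, U.rightPerp.leftPerp = U) ∧
      (∀ U : ThickSubcategory T, U.leftPerp.rightPerp = U) ∧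
      ∃ e : ThickSubcategory T ≃o (ThickSubcategory T)ᵒᵈ,
        (∀ U, e U = OrderDual.toDual U.rightPerp) ∧
        (∀ U, e.symm (OrderDual.toDual U) = U.leftPerp)) ∧
    -- (2)
    (∀ U : ThickSubcategory T, U ⊓ U.rightPerp = ⊥ ∧ U ⊔ U.rightPerp = ⊤) ∧
    -- (3) here `X / V` is regarded as a full subcategory of `U / V` via the canonical functor
    (∀ V U : ThickSubcategory T, V ≤ U →
      IsLocallyFinite.{w} (ThickSubcategory.SubQuotient U V) ∧
      ∃ e : Set.Icc V U ≃o ThickSubcategory (ThickSubcategory.SubQuotient U V),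
        ∀ X : Set.Icc V U,
          (ThickSubcategory.quotientFunctor X.2.2 V).Full ∧
          (ThickSubcategory.quotientFunctor X.2.2 V).Faithful ∧
          (e X).obj = (ThickSubcategory.quotientFunctor X.2.2 V).essImage) := by
  refine ⟨⟨ThickSubcategory.leftPerp_rightPerp hT, ThickSubcategory.rightPerp_leftPerp hT,
    ThickSubcategory.perpOrderIso hT, fun _ => rfl, fun _ => rfl⟩,
    fun U => ⟨U.inf_rightPerp, U.sup_rightPerp hT⟩, fun V U hVU => ⟨?_, ?_⟩⟩
  · exact (hT.fullSubcategory U.obj).of_isLocalization (V.restrict U).obj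
      (V.restrict U).obj.trW.Q
  · refine ⟨ThickSubcategory.intervalOrderIso hVU, fun X => ?_⟩
    obtain ⟨h⟩ := ThickSubcategory.nonempty_fullyFaithful_quotientFunctor X.2.1 X.2.2
    exact ⟨h.full, h.faithful, (ThickSubcategory.essImage_quotientFunctor hVU X).symm⟩
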